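/- Heyting algebras are considered in the signature $\{\land,\lor,\to,\neg\}$, formulas are propositional formulas in this signature over countably many variables, and $\mathcal H\models A$ means that $A$ takes the value $1$ under every valuation in $\mathcal H$. A variety is a class of Heyting algebras axiomatized by a set of formulas. The opremum of an algebra is the greatest of its elements distinct from $1$. A pair $\langle A(p_1,\dots,p_n),\nu\rangle$ is a presentation of an algebra $\mathcal H$ over a variety $\mathcal V$ if the elements $\nu(p_1),\dots,\nu(p_n)$ generate $\mathcal H$, $\nu(A)=1$, and for every formula $B(p_1,\dots,p_n)$ with $\nu(B)=1$ the formula $A\to B$ is valid in all algebras of $\mathcal V$. Let $FPSI(\mathcal V)$ be the class of all subdirectly irreducible algebras in $\mathcal V$ that have a presentation over $\mathcal V$. A characteristic formula of $\mathcal H\in FPSI(\mathcal V)$ over $\mathcal V$ is a formula $A\to B$, where $\langle A(p_1,\dots,p_n),\nu\rangle$ is a presentation of $\mathcal H$ over $\mathcal V$ and $B(p_1,\dots,p_n)$ is a formula such that $\nu(B)$ is the opremum of $\mathcal H$. The Jankov formula of a finite subdirectly irreducible algebra $\mathcal H=\{a_1,\dots,a_n\}$ is $D(p_1,\dots,p_n)\to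 p_\omega$, where $a_\omega$ is the opremum of $\mathcal H$ and $D$ is the conjunction of all formulas $(p_i\circ p_j)\leftrightarrow p_k$ with $a_i\circ a_j=a_k$, $\circ\in\{\land,\lor,\to\}$, and all $\neg p_i\leftrightarrow p_j$ with $\neg a_i=a_j$. A variety is axiomatized by characteristic (respectively Jankov) formulas if it is the class of all Heyting algebras validating some set of formulas that are characteristic formulas over one and the same variety (respectively Jankov formulas). Theorem. There is a continuum of varieties of Heyting algebras that are axiomatized by characteristic formulas but cannot be axiomatized by Jankov formulas: the set of these varieties has cardinality $2^{\aleph_0}$. More precisely, there are a variety $\mathcal V$ and infinite algebras $\mathcal H_0,\mathcal H_1,\dots\in FPSI(\mathcal V)$ such that for $k\neq m$ the algebra $\mathcal H_k$ is not embeddable into any homomorphic image of $\mathcal H_m$, and such that, for any choice of characteristic formulas $\chi_k$ of $\mathcal H_k$ over $\mathcal V$, 1. the set $\{\chi_k : k\in\mathbb N\}$ is $\mathcal V$-independent, that is, for each of its members there is an algebra in $\mathcal V$ that refutes it and validates all the other members; 2. for distinct sets $S\subseteq\mathbb N$ the varieties axiomatized by $\{\chi_k : k\in S\}$ are distinct;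 3. for every non-empty $S\subseteq\mathbb N$ the variety axiomatized by $\{\chi_k : k\in S\}$ cannot be axiomatized by Jankov formulas. -/

import Mathlib

namespace CharForm

/-- Propositional formulas in the signature `∧, ∨, →, ¬` over the variables `p₀, p₁, …`. -/
inductive PropForm : Type
  | var (i : ℕ) : PropForm
  | and (A B : PropForm) : PropForm
  | or (A B : PropForm) : PropForm
  | imp (A B : PropForm) : PropForm
  | neg (A : PropForm) : PropForm

namespace PropForm

/-- `A ↔ B` abbreviates `(A → B) ∧ (B → A)`. -/
def iff (A B : PropForm) : PropForm := (A.imp B).and (B.imp A)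

/-- The finite set of variables occurring in a formula. -/
def vars : PropForm → Finset ℕ
  | var i => {i}
  | and A B => A.vars ∪ B.vars
  | or A B => A.vars ∪ B.vars
  | imp A B => A.vars ∪ B.vars
  | neg A => A.vars

/-- The value of a formula in a Heyting algebra under a valuation of the variables. -/
def eval {H : Type} [HeytingAlgebra H] (ν : ℕ → H) : PropForm → H
  | var i => ν i
  | and A B => A.eval ν ⊓ B.eval ν
  | or A B => A.eval ν ⊔ B.eval ν
  | imp A B => A.eval ν ⇨ B.eval ν
  | neg A => (A.eval ν)ᶜ

/-- The conjunction of a list of formulas (a tautology if the list is empty). -/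
def conj : List PropForm → PropForm
  | [] => (var 0).imp (var 0)
  | [A] => A
  | A :: B :: l => A.and (conj (B :: l))

end PropForm

/-! ### Validity and varieties -/

/-- `H ⊨ A`: the formula `A` takes the value `1` under every valuation in `H`. -/
def Valid (H : HeytAlg.{0}) (A : PropForm) : Prop :=
  ∀ ν : ℕ → H, A.eval ν = ⊤

/-- The class of all Heyting algebras in which all formulas of `Γ` are valid. -/
def Mod (Γ : Set PropForm) : Set HeytAlg.{0} :=
  {H | ∀ A ∈ Γ, Valid H A}

/-- A variety (equational class) of Heyting algebras. In Heyting algebras every equation `s = t` is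
equivalent to the validity of `s ↔ t`, and the validity of `A` to the equation `A = (A → A)`. -/
def IsVariety (V : Set HeytAlg.{0}) : Prop :=
  ∃ Γ : Set PropForm, V = Mod Γ

/-- `Γ ⊢_V A`: every algebra of `V` that validates all formulas of `Γ` validates `A`. -/
def Derivable (V : Set HeytAlg.{0}) (Γ : Set PropForm) (A : PropForm) : Prop :=
  ∀ H ∈ V, (∀ C ∈ Γ, Valid H C) → Valid H A

/-- A set of formulas is `V`-independent if none of its members is derivable over `V` from the
other ones. -/
def Independent (V : Set HeytAlg.{0}) (Γ : Set PropForm) : Prop :=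
  ∀ A ∈ Γ, ¬ Derivable V (Γ \ {A}) A

/-- `A ∈ SH(B)`: `A` is embeddable into a homomorphic image of `B`. -/
def InSH (A B : HeytAlg.{0}) : Prop :=
  ∃ (C : HeytAlg.{0}) (f : HeytingHom B C) (g : HeytingHom A C),
    Function.Surjective f ∧ Function.Injective g

/-! ### Subdirectly irreducible and finitely presentable algebras -/

/-- A congruence of a Heyting algebra. -/
structure IsCongruence {H : Type} [HeytingAlgebra H] (θ : Setoid H) : Prop where
  inf : ∀ a b c d : H, θ a b → θ c d → θ (a ⊓ c) (b ⊓ d)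
  sup : ∀ a b c d : H, θ a b → θ c d → θ (a ⊔ c) (b ⊔ d)
  himp : ∀ a b c d : H, θ a b → θ c d → θ (a ⇨ c) (b ⇨ d)
  compl : ∀ a b : H, θ a b → θ aᶜ bᶜ

/-- Subdirect irreducibility: the intersection of all congruences different from equality is itself
different from equality. In particular the algebra is not degenerate. -/
def SubdirectlyIrreducible (H : Type) [HeytingAlgebra H] : Prop :=
  ∃ a b : H, a ≠ b ∧ ∀ θ : Setoid H, IsCongruence θ → θ ≠ ⊥ → θ a b

/-- The opremum: the greatest of the elements distinct from `1`. -/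
def IsOpremum {H : Type} [HeytingAlgebra H] (ω : H) : Prop :=
  IsGreatest {x : H | x ≠ ⊤} ω

/-- The set `G` generates the Heyting algebra `H`. -/
def Generates {H : Type} [HeytingAlgebra H] (G : Set H) : Prop :=
  ∀ T : Set H, G ⊆ T →
    (∀ a ∈ T, ∀ b ∈ T, a ⊓ b ∈ T ∧ a ⊔ b ∈ T ∧ a ⇨ b ∈ T) → (∀ a ∈ T, aᶜ ∈ T) → T = Set.univ

/-- The pair `⟨A, ν⟩`, where `A` is a formula in the variables from the finite list `P`, defines the
algebra `H` over `V`. -/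
structure Defines (V : Set HeytAlg.{0}) (P : Finset ℕ) (A : PropForm) (H : HeytAlg.{0})
    (ν : ℕ → H) : Prop where
  vars_subset : A.vars ⊆ P
  generates : Generates (ν '' (P : Set ℕ))
  eval_eq : A.eval ν = ⊤
  valid_imp : ∀ B : PropForm, B.vars ⊆ P → B.eval ν = ⊤ → ∀ K ∈ V, Valid K (A.imp B)

/-- `H` is finitely presentable over `V`. -/
def FinitelyPresentable (V : Set HeytAlg.{0}) (H : HeytAlg.{0}) : Prop :=
  ∃ (P : Finset ℕ) (A : PropForm) (ν : ℕ → H), Defines V P A H ν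

/-- The class of all subdirectly irreducible algebras of `V` that are finitely presentable
over `V`. -/
def FPSI (V : Set HeytAlg.{0}) : Set HeytAlg.{0} :=
  {H | H ∈ V ∧ SubdirectlyIrreducible H ∧ FinitelyPresentable V H}

/-! ### Characteristic formulas and Jankov formulas -/

/-- `χ` is a characteristic formula of the algebra `H` over the variety `V`: `H` is a subdirectly
irreducible algebra of `V` and `χ = A → B`, where `⟨A, ν⟩` is a presentation of `H` over `V` and
`ν(B)` is the opremum of `H`. -/
def IsCharFormula (V : Set HeytAlg.{0}) (H : HeytAlg.{0}) (χ : PropForm) : Prop :=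
  H ∈ V ∧ SubdirectlyIrreducible H ∧
    ∃ (P : Finset ℕ) (A B : PropForm) (ν : ℕ → H),
      Defines V P A H ν ∧ B.vars ⊆ P ∧ IsOpremum (B.eval ν) ∧ χ = A.imp B

/-- The diagram formula of the finite algebra `H = {e 0, …, e (n - 1)}`, in which the variable `pᵢ`
stands for the element `e i`. -/
def diagram {H : Type} [HeytingAlgebra H] {n : ℕ} (e : Fin n ≃ H) : PropForm :=
  let p : H → PropForm := fun a => .var (e.symm a : ℕ)
  let elems : List H := (List.finRange n).map e
  let pairs : List (H × H) := elems.product elems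
  .conj
    (pairs.map (fun a => ((p a.1).and (p a.2)).iff (p (a.1 ⊓ a.2))) ++
     pairs.map (fun a => ((p a.1).or (p a.2)).iff (p (a.1 ⊔ a.2))) ++
     pairs.map (fun a => ((p a.1).imp (p a.2)).iff (p (a.1 ⇨ a.2))) ++
     elems.map (fun a => (p a).neg.iff (p aᶜ)))

/-- `χ` is the Jankov formula of some finite subdirectly irreducible algebra (under some enumeration
of its elements). -/
def IsJankovFormula (χ : PropForm) : Prop :=
  ∃ (H : HeytAlg.{0}) (n : ℕ) (e : Fin n ≃ H) (ω : H),
    SubdirectlyIrreducible H ∧ IsOpremum ω ∧ χ = (diagram e).imp (.var (e.symm ω : ℕ))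

/-- The class `W` is axiomatized by characteristic formulas, all of them over one variety `V`. -/
def AxiomatizedByCharFormulas (W : Set HeytAlg.{0}) : Prop :=
  ∃ V : Set HeytAlg.{0}, IsVariety V ∧
    ∃ Γ : Set PropForm, (∀ χ ∈ Γ, ∃ H, IsCharFormula V H χ) ∧ W = Mod Γ

/-- The class `W` is axiomatized by Jankov formulas. -/
def AxiomatizedByJankovFormulas (W : Set HeytAlg.{0}) : Prop :=
  ∃ Γ : Set PropForm, (∀ χ ∈ Γ, IsJankovFormula χ) ∧ W = Mod Γ

end CharForm

namespace CharForm

/-! ### Quotients, varieties and refutation of characteristic formulas -/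

section Relativization

variable {K : Type} [HeytingAlgebra K]

/-- The quotient of a Heyting algebra by the principal filter generated by `a`, realized on the
interval below `a`. -/
@[reducible] def iicHeyting (a : K) : HeytingAlgebra {x : K // x ≤ a} where
  sup x y := ⟨x.1 ⊔ y.1, sup_le x.2 y.2⟩
  le_sup_left x y := Subtype.coe_le_coe.1 le_sup_left
  le_sup_right x y := Subtype.coe_le_coe.1 le_sup_right
  sup_le x y z h₁ h₂ := Subtype.coe_le_coe.1 (sup_le (Subtype.coe_le_coe.2 h₁) h₂)
  inf x y := ⟨x.1 ⊓ y.1, inf_le_left.trans x.2⟩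
  inf_le_left x y := Subtype.coe_le_coe.1 inf_le_left
  inf_le_right x y := Subtype.coe_le_coe.1 inf_le_right
  le_inf x y z h₁ h₂ := Subtype.coe_le_coe.1 (le_inf (Subtype.coe_le_coe.2 h₁) h₂)
  top := ⟨a, le_rfl⟩
  le_top x := x.2
  bot := ⟨⊥, bot_le⟩
  bot_le x := Subtype.coe_le_coe.1 bot_le
  himp x y := ⟨(x.1 ⇨ y.1) ⊓ a, inf_le_right⟩
  le_himp_iff x y z := by
    rw [← Subtype.coe_le_coe, ← Subtype.coe_le_coe]
    change x.1 ≤ (y.1 ⇨ z.1) ⊓ a ↔ x.1 ⊓ y.1 ≤ z.1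
    rw [le_inf_iff, le_himp_iff]
    exact ⟨fun h => h.1, fun h => ⟨h, x.2⟩⟩
  compl x := ⟨(x.1)ᶜ ⊓ a, inf_le_right⟩
  himp_bot x := by
    apply Subtype.ext
    change (x.1 ⇨ ⊥) ⊓ a = (x.1)ᶜ ⊓ a
    rw [himp_bot]

theorem himp_inf_congr (x y a : K) : (x ⇨ y) ⊓ a = ((x ⊓ a) ⇨ (y ⊓ a)) ⊓ a := by
  apply le_antisymm
  · refine le_inf ?_ inf_le_right
    rw [le_himp_iff]
    refine le_inf ?_ (inf_le_left.trans inf_le_right)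
    calc (x ⇨ y) ⊓ a ⊓ (x ⊓ a) ≤ (x ⇨ y) ⊓ x := inf_le_inf inf_le_left inf_le_left
      _ ≤ y := himp_inf_le
  · refine le_inf ?_ inf_le_right
    rw [le_himp_iff]
    calc ((x ⊓ a) ⇨ (y ⊓ a)) ⊓ a ⊓ x = ((x ⊓ a) ⇨ (y ⊓ a)) ⊓ (x ⊓ a) := by
          rw [inf_assoc, inf_comm a x]
      _ ≤ y ⊓ a := himp_inf_le
      _ ≤ y := inf_le_left

end Relativization

/-- A map that is an injective homomorphism modulo the principal filter of `a` embeds `H` into a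
homomorphic image of `K`. -/
theorem inSH_of_map {H K : HeytAlg.{0}} (a : K) (g : H → K)
    (hinf : ∀ x y, g (x ⊓ y) ⊓ a = g x ⊓ g y ⊓ a)
    (hsup : ∀ x y, g (x ⊔ y) ⊓ a = (g x ⊔ g y) ⊓ a)
    (himp : ∀ x y, g (x ⇨ y) ⊓ a = (g x ⇨ g y) ⊓ a)
    (hbot : g ⊥ ⊓ a = ⊥) (hinj : ∀ x y, g x ⊓ a = g y ⊓ a → x = y) : InSH H K := by
  let _ := iicHeyting a
  refine ⟨HeytAlg.of {x : K // x ≤ a},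
    { toFun := fun x => (⟨x ⊓ a, inf_le_right⟩ : {x : K // x ≤ a})
      map_sup' := fun x y => Subtype.ext (inf_sup_right x y a)
      map_inf' := fun x y => Subtype.ext (inf_inf_distrib_right x y a)
      map_bot' := Subtype.ext (bot_inf_eq _)
      map_himp' := fun x y => Subtype.ext (himp_inf_congr x y a) },
    { toFun := fun x => (⟨g x ⊓ a, inf_le_right⟩ : {x : K // x ≤ a})
      map_sup' := fun x y => Subtype.ext ((hsup x y).trans (inf_sup_right _ _ _))
      map_inf' := fun x y => Subtype.ext ((hinf x y).trans (inf_inf_distrib_right _ _ _))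
      map_bot' := Subtype.ext hbot
      map_himp' := fun x y => Subtype.ext ((himp x y).trans (himp_inf_congr _ _ _)) }, ?_, ?_⟩
  · intro x
    exact ⟨x.1, Subtype.ext (inf_eq_left.2 x.2)⟩
  · intro x y h
    exact hinj x y (congrArg Subtype.val h)

theorem eval_map {H K : Type} [HeytingAlgebra H] [HeytingAlgebra K] (f : HeytingHom H K)
    (ν : ℕ → H) (A : PropForm) : A.eval (fun i => f (ν i)) = f (A.eval ν) := by
  induction A with
  | var i => rfl
  | and A B hA hB => simp [PropForm.eval, hA, hB]
  | or A B hA hB => simp [PropForm.eval, hA, hB]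
  | imp A B hA hB => simp [PropForm.eval, hA, hB]
  | neg A hA => simp [PropForm.eval, hA]

/-- If `H` embeds into a homomorphic image of `K`, every valuation in `H` is matched by one
in `K`. -/
theorem InSH.exists_valuation {H K : HeytAlg.{0}} (h : InSH H K) (ν : ℕ → H) :
    ∃ μ : ℕ → K, ∀ A : PropForm, A.eval μ = ⊤ → A.eval ν = ⊤ := by
  obtain ⟨C, f, g, hf, hg⟩ := h
  choose s hs using hf
  refine ⟨fun i => s (g (ν i)), fun A hA => hg ?_⟩
  rw [← eval_map, map_top, ← map_top f, ← hA, ← eval_map]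
  simp only [hs]

theorem InSH.valid {H K : HeytAlg.{0}} (h : InSH H K) {A : PropForm} (hA : Valid K A) :
    Valid H A := fun ν => by
  obtain ⟨μ, hμ⟩ := h.exists_valuation ν
  exact hμ A (hA μ)

theorem IsVariety.mem_of_inSH {V : Set HeytAlg.{0}} (hV : IsVariety V) {H K : HeytAlg.{0}}
    (h : InSH H K) (hK : K ∈ V) : H ∈ V := by
  obtain ⟨Γ, rfl⟩ := hV
  exact fun A hA => h.valid (hK A hA)

theorem InSH.finite {H K : HeytAlg.{0}} (h : InSH H K) [Finite K] : Finite H := by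
  obtain ⟨C, f, g, hf, hg⟩ := h
  have := Finite.of_surjective f hf
  exact Finite.of_injective g hg

/-- An algebra with an opremum is subdirectly irreducible. -/
theorem IsOpremum.subdirectlyIrreducible {H : Type} [HeytingAlgebra H] {ω : H}
    (hω : IsOpremum ω) : SubdirectlyIrreducible H := by
  refine ⟨⊤, ω, fun h => hω.1 h.symm, fun θ hθ hne => ?_⟩
  have key : ∀ w : H, w ≠ ⊤ → θ w ⊤ → θ ⊤ ω := fun w hw h => by
    have h1 := hθ.sup _ _ _ _ h (θ.refl ω)
    rw [sup_eq_right.2 (hω.2 hw), top_sup_eq] at h1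
    exact θ.symm h1
  have : ∃ u v, θ u v ∧ u ≠ v := by
    by_contra! hcon
    refine hne (le_antisymm (fun u v h => hcon u v h) bot_le)
  obtain ⟨u, v, huv, hne⟩ := this
  by_cases h : u ≤ v
  · refine key (v ⇨ u) (fun h' => hne (le_antisymm h (himp_eq_top_iff.1 h'))) ?_
    have := hθ.himp _ _ _ _ (θ.symm huv) (θ.refl u)
    rwa [himp_self] at this
  · refine key (u ⇨ v) (fun h' => h (himp_eq_top_iff.1 h')) ?_
    have := hθ.himp _ _ _ _ huv (θ.refl v)
    rwa [himp_self] at this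

theorem Generates.exists_formula {H : Type} [HeytingAlgebra H] {P : Finset ℕ} {ν : ℕ → H}
    (h : Generates (ν '' (P : Set ℕ))) (x : H) :
    ∃ E : PropForm, E.vars ⊆ P ∧ E.eval ν = x := by
  have := h {x | ∃ E : PropForm, E.vars ⊆ P ∧ E.eval ν = x} ?_ ?_ ?_
  · exact this.ge (Set.mem_univ x)
  · rintro _ ⟨i, hi, rfl⟩
    exact ⟨.var i, by simpa [PropForm.vars] using hi, rfl⟩
  · rintro _ ⟨E, hE, rfl⟩ _ ⟨F, hF, rfl⟩
    exact ⟨⟨E.and F, Finset.union_subset hE hF, rfl⟩, ⟨E.or F, Finset.union_subset hE hF, rfl⟩,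
      ⟨E.imp F, Finset.union_subset hE hF, rfl⟩⟩
  · rintro _ ⟨E, hE, rfl⟩
    exact ⟨E.neg, hE, rfl⟩

theorem inf_eq_inf_of_le_himp {K : Type} [HeytingAlgebra K] {a x y : K} (h₁ : a ≤ x ⇨ y)
    (h₂ : a ≤ y ⇨ x) : x ⊓ a = y ⊓ a := by
  rw [le_himp_iff, inf_comm] at h₁ h₂
  exact le_antisymm (le_inf h₁ inf_le_right) (le_inf h₂ inf_le_right)

theorem le_himp_of_inf_eq {K : Type} [HeytingAlgebra K] {a x y : K} (h : x ⊓ a = y ⊓ a) :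
    a ≤ x ⇨ y := by
  rw [le_himp_iff, inf_comm, h]
  exact inf_le_left

theorem IsCharFormula.not_valid {V : Set HeytAlg.{0}} {H : HeytAlg.{0}} {χ : PropForm}
    (h : IsCharFormula V H χ) : ¬ Valid H χ := by
  obtain ⟨-, -, P, A, B, ν, hd, -, hω, rfl⟩ := h
  intro hv
  have := hv ν
  rw [PropForm.eval, hd.eval_eq, top_himp] at this
  exact hω.1 this

/-- An algebra of the variety that refutes a characteristic formula of `H` has `H` as a subalgebra
of a homomorphic image. -/
theorem IsCharFormula.inSH {V : Set HeytAlg.{0}} {H K : HeytAlg.{0}} {χ : PropForm}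
    (h : IsCharFormula V H χ) (hK : K ∈ V) (hr : ¬ Valid K χ) : InSH H K := by
  obtain ⟨-, -, P, A, B, ν, hd, hB, hω, rfl⟩ := h
  unfold Valid at hr
  push Not at hr
  obtain ⟨μ, hμ⟩ := hr
  choose E hEP hEν using hd.generates.exists_formula
  have key : ∀ F : PropForm, F.vars ⊆ P → F.eval ν = ⊤ → A.eval μ ≤ F.eval μ :=
    fun F hF hFν => himp_eq_top_iff.1 (hd.valid_imp F hF hFν K hK μ)
  have congr : ∀ F G : PropForm, F.vars ⊆ P → G.vars ⊆ P → F.eval ν = G.eval ν →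
      F.eval μ ⊓ A.eval μ = G.eval μ ⊓ A.eval μ := fun F G hF hG hFG =>
    inf_eq_inf_of_le_himp
      (key (F.imp G) (Finset.union_subset hF hG) (by rw [PropForm.eval, hFG, himp_self]))
      (key (G.imp F) (Finset.union_subset hG hF) (by rw [PropForm.eval, hFG, himp_self]))
  refine inSH_of_map (A.eval μ) (fun x => (E x).eval μ) ?_ ?_ ?_ ?_ ?_
  · exact fun x y => congr _ ((E x).and (E y)) (hEP _) (Finset.union_subset (hEP _) (hEP _))
      (by simp only [PropForm.eval, hEν])
  · exact fun x y => congr _ ((E x).or (E y)) (hEP _) (Finset.union_subset (hEP _) (hEP _))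
      (by simp only [PropForm.eval, hEν])
  · exact fun x y => congr _ ((E x).imp (E y)) (hEP _) (Finset.union_subset (hEP _) (hEP _))
      (by simp only [PropForm.eval, hEν])
  · refine (congr _ ((E ⊥).and (E ⊥).neg) (hEP _) (Finset.union_subset (hEP _) (hEP _))
      (by simp only [PropForm.eval, hEν, inf_compl_self])).trans ?_
    simp [PropForm.eval]
  · have main : ∀ x y, (E x).eval μ ⊓ A.eval μ = (E y).eval μ ⊓ A.eval μ → x ≤ y := by
      intro x y hxy
      by_contra hle
      have h1 : A.eval μ ≤ ((E x).imp (E y)).eval μ := le_himp_of_inf_eq hxy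
      have h2 := key (((E x).imp (E y)).imp B)
        (Finset.union_subset (Finset.union_subset (hEP _) (hEP _)) hB) (by
          rw [PropForm.eval, himp_eq_top_iff]
          refine hω.2 fun h => hle ?_
          rwa [PropForm.eval, hEν, hEν, himp_eq_top_iff] at h)
      refine hμ ?_
      rw [PropForm.eval, himp_eq_top_iff]
      rw [PropForm.eval, le_himp_iff, inf_eq_left.2 h1] at h2
      exact h2
    exact fun x y hxy => le_antisymm (main x y hxy) (main y x hxy.symm)

/-! ### Jankov formulas -/

theorem eval_conj_le {H : Type} [HeytingAlgebra H] (ν : ℕ → H) {l : List PropForm} {A : PropForm}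
    (hA : A ∈ l) : (PropForm.conj l).eval ν ≤ A.eval ν := by
  induction l with
  | nil => simp at hA
  | cons C l ih =>
    cases l with
    | nil => simp only [List.mem_singleton] at hA; subst hA; exact le_rfl
    | cons D l =>
      rcases List.mem_cons.1 hA with rfl | h
      · exact inf_le_left
      · exact inf_le_right.trans (ih h)

theorem eval_conj_eq_top {H : Type} [HeytingAlgebra H] (ν : ℕ → H) {l : List PropForm}
    (h : ∀ A ∈ l, A.eval ν = ⊤) : (PropForm.conj l).eval ν = ⊤ := by
  induction l with
  | nil => simp [PropForm.conj, PropForm.eval]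
  | cons C l ih =>
    cases l with
    | nil => exact h C (by simp)
    | cons D l =>
      rw [PropForm.conj, PropForm.eval, h C (by simp), ih fun A hA => h A (by simp_all), inf_top_eq]

theorem eval_iff_eq_top {H : Type} [HeytingAlgebra H] (ν : ℕ → H) {A B : PropForm} :
    (A.iff B).eval ν = ⊤ ↔ A.eval ν = B.eval ν := by
  simp only [PropForm.iff, PropForm.eval, inf_eq_top_iff, himp_eq_top_iff]
  exact ⟨fun h => le_antisymm h.1 h.2, fun h => ⟨h.le, h.ge⟩⟩

theorem inf_eq_of_le_eval_iff {H : Type} [HeytingAlgebra H] (ν : ℕ → H) {A B : PropForm} {a : H}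
    (h : a ≤ (A.iff B).eval ν) : A.eval ν ⊓ a = B.eval ν ⊓ a :=
  inf_eq_inf_of_le_himp (h.trans inf_le_left) (h.trans inf_le_right)

section Jankov

variable {F : HeytAlg.{0}} {n : ℕ} (e : Fin n ≃ F)

theorem mem_elems (x : F) : x ∈ (List.finRange n).map e :=
  List.mem_map.2 ⟨e.symm x, List.mem_finRange _, e.apply_symm_apply x⟩

theorem mem_pairs (x y : F) :
    (x, y) ∈ ((List.finRange n).map e).product ((List.finRange n).map e) :=
  List.pair_mem_product.2 ⟨mem_elems e x, mem_elems e y⟩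

/-- A finite algebra refutes its own Jankov formula. -/
theorem not_valid_jankov {ω : F} (hω : IsOpremum ω) :
    ¬ Valid F ((diagram e).imp (.var (e.symm ω : ℕ))) := by
  intro hv
  let ν : ℕ → F := fun i => if h : i < n then e ⟨i, h⟩ else ⊤
  have hν : ∀ x : F, ν (e.symm x : ℕ) = x := fun x => by simp [ν]
  have hd : (diagram e).eval ν = ⊤ := by
    refine eval_conj_eq_top ν fun A hA => ?_
    simp only [List.mem_append, List.mem_map] at hA
    rcases hA with ((⟨x, -, rfl⟩ | ⟨x, -, rfl⟩) | ⟨x, -, rfl⟩) | ⟨x, -, rfl⟩ <;>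
      simp only [eval_iff_eq_top, PropForm.eval, hν]
  have := hv ν
  rw [PropForm.eval, hd, top_himp, PropForm.eval, hν] at this
  exact hω.1 this

/-- An algebra refuting the Jankov formula of `F` has `F` as a subalgebra of a homomorphic
image. -/
theorem inSH_of_not_valid_jankov {ω : F} (hω : IsOpremum ω) {K : HeytAlg.{0}}
    (h : ¬ Valid K ((diagram e).imp (.var (e.symm ω : ℕ)))) : InSH F K := by
  unfold Valid at h
  push Not at h
  obtain ⟨μ, hμ⟩ := h
  have le : ∀ A : PropForm, A ∈ (_ : List PropForm) → (diagram e).eval μ ≤ A.eval μ :=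
    fun A hA => eval_conj_le μ hA
  simp only [List.mem_append, List.mem_map] at le
  have hinf : ∀ x y : F, μ (e.symm (x ⊓ y)) ⊓ (diagram e).eval μ =
      μ (e.symm x) ⊓ μ (e.symm y) ⊓ (diagram e).eval μ := fun x y =>
    (inf_eq_of_le_eval_iff μ
      (le _ (.inl (.inl (.inl ⟨(x, y), mem_pairs e x y, rfl⟩))))).symm
  have hsup : ∀ x y : F, μ (e.symm (x ⊔ y)) ⊓ (diagram e).eval μ =
      (μ (e.symm x) ⊔ μ (e.symm y)) ⊓ (diagram e).eval μ := fun x y =>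
    (inf_eq_of_le_eval_iff μ
      (le _ (.inl (.inl (.inr ⟨(x, y), mem_pairs e x y, rfl⟩))))).symm
  have himp : ∀ x y : F, μ (e.symm (x ⇨ y)) ⊓ (diagram e).eval μ =
      (μ (e.symm x) ⇨ μ (e.symm y)) ⊓ (diagram e).eval μ := fun x y =>
    (inf_eq_of_le_eval_iff μ
      (le _ (.inl (.inr ⟨(x, y), mem_pairs e x y, rfl⟩)))).symm
  have hcompl : ∀ x : F, μ (e.symm xᶜ) ⊓ (diagram e).eval μ =
      (μ (e.symm x))ᶜ ⊓ (diagram e).eval μ := fun x =>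
    (inf_eq_of_le_eval_iff μ (le _ (.inr ⟨x, List.mem_map.1 (mem_elems e x), rfl⟩))).symm
  refine inSH_of_map ((diagram e).eval μ) (fun x => μ (e.symm x)) hinf hsup himp ?_ ?_
  · have h1 := hinf ⊥ ⊥ᶜ
    rw [bot_inf_eq, inf_assoc, hcompl, ← inf_assoc, inf_compl_self, bot_inf_eq] at h1
    exact h1
  · have htop : (diagram e).eval μ ≤ μ (e.symm ⊤) := by
      have h1 := himp ⊤ ⊤
      rw [himp_self, himp_self, top_inf_eq] at h1
      exact inf_eq_right.1 h1
    have main : ∀ x y : F, μ (e.symm x) ⊓ (diagram e).eval μ =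
        μ (e.symm y) ⊓ (diagram e).eval μ → x ≤ y := by
      intro x y hxy
      by_contra hle
      have h1 : (diagram e).eval μ ≤ μ (e.symm (x ⇨ y)) := by
        have h2 := himp x y
        rw [inf_eq_right.2 (le_himp_of_inf_eq hxy)] at h2
        exact inf_eq_right.1 h2
      have h3 : x ⇨ y ≤ ω := hω.2 fun h => hle (himp_eq_top_iff.1 h)
      have h4 := hsup (x ⇨ y) ω
      rw [sup_eq_right.2 h3, inf_eq_right.2 (h1.trans le_sup_left)] at h4
      refine hμ ?_
      rw [PropForm.eval, himp_eq_top_iff]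
      exact inf_eq_right.1 h4
    exact fun x y hxy => le_antisymm (main x y hxy) (main y x hxy.symm)

end Jankov

/-! ### Antichains of infinite finitely presentable algebras -/

section Antichain

variable {V : Set HeytAlg.{0}} {H : ℕ → HeytAlg.{0}} {χ : ℕ → PropForm}

theorem valid_charFormula_iff (hHV : ∀ k, H k ∈ V)
    (hSH : ∀ k m, k ≠ m → ¬ InSH (H k) (H m)) (hχ : ∀ k, IsCharFormula V (H k) (χ k)) (k m : ℕ) :
    Valid (H m) (χ k) ↔ k ≠ m := by
  constructor
  · rintro h rfl
    exact (hχ k).not_valid h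
  · intro h
    by_contra hv
    exact hSH k m h ((hχ k).inSH (hHV m) hv)

theorem independent_range (hHV : ∀ k, H k ∈ V)
    (hSH : ∀ k m, k ≠ m → ¬ InSH (H k) (H m)) (hχ : ∀ k, IsCharFormula V (H k) (χ k)) :
    Independent V (Set.range χ) := by
  rintro _ ⟨k, rfl⟩ hd
  refine (hχ k).not_valid (hd (H k) (hHV k) ?_)
  rintro _ ⟨⟨m, rfl⟩, hm⟩
  refine (valid_charFormula_iff hHV hSH hχ m k).2 ?_
  rintro rfl
  exact hm rfl

theorem mem_mod_image_iff (hHV : ∀ k, H k ∈ V)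
    (hSH : ∀ k m, k ≠ m → ¬ InSH (H k) (H m)) (hχ : ∀ k, IsCharFormula V (H k) (χ k))
    (S : Set ℕ) (m : ℕ) : H m ∈ Mod (χ '' S) ↔ m ∉ S := by
  constructor
  · exact fun h hm => (hχ m).not_valid (h _ ⟨m, hm, rfl⟩)
  · rintro hm _ ⟨k, hk, rfl⟩
    refine (valid_charFormula_iff hHV hSH hχ k m).2 ?_
    rintro rfl
    exact hm hk

theorem mod_image_injective (hHV : ∀ k, H k ∈ V)
    (hSH : ∀ k m, k ≠ m → ¬ InSH (H k) (H m)) (hχ : ∀ k, IsCharFormula V (H k) (χ k)) :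
    Function.Injective (fun S : Set ℕ => Mod (χ '' S)) := by
  intro S S' h
  ext m
  have h1 := mem_mod_image_iff hHV hSH hχ S m
  have h2 := mem_mod_image_iff hHV hSH hχ S' m
  simp only at h
  rw [h] at h1
  exact not_iff_not.1 (h1.symm.trans h2)

/-- Finite algebras of the variety validate the characteristic formulas of infinite algebras, so
these formulas are not interchangeable with Jankov formulas. -/
theorem not_axiomatizedByJankovFormulas (hV : IsVariety V) (hHV : ∀ k, H k ∈ V)
    (hinf : ∀ k, Infinite (H k)) (hχ : ∀ k, IsCharFormula V (H k) (χ k)) {S : Set ℕ}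
    (hS : S.Nonempty) : ¬ AxiomatizedByJankovFormulas (Mod (χ '' S)) := by
  rintro ⟨Γ, hΓ, hW⟩
  obtain ⟨k, hk⟩ := hS
  have hk' : H k ∉ Mod Γ := by
    rw [← hW]
    exact fun h => (hχ k).not_valid (h _ ⟨k, hk, rfl⟩)
  have : ∃ C ∈ Γ, ¬ Valid (H k) C := by
    by_contra! hcon
    exact hk' hcon
  obtain ⟨C, hC, hCv⟩ := this
  obtain ⟨F, n, e, ω, -, hω, rfl⟩ := hΓ C hC
  have hF : InSH F (H k) := inSH_of_not_valid_jankov e hω hCv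
  have hF' : F ∉ Mod (χ '' S) := by
    rw [hW]
    exact fun h => not_valid_jankov e hω (h _ hC)
  have : ∃ m ∈ S, ¬ Valid F (χ m) := by
    by_contra! hcon
    refine hF' ?_
    rintro _ ⟨m, hm, rfl⟩
    exact hcon m hm
  obtain ⟨m, -, hm⟩ := this
  have : Finite F := Finite.of_equiv _ e
  have := ((hχ m).inSH (hV.mem_of_inSH hF (hHV k)) hm).finite
  exact (hinf m).not_finite this

/-- An injective numbering of formulas. -/
def PropForm.code : PropForm → ℕ
  | .var i => Nat.pair 0 i
  | .and A B => Nat.pair 1 (Nat.pair A.code B.code)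
  | .or A B => Nat.pair 2 (Nat.pair A.code B.code)
  | .imp A B => Nat.pair 3 (Nat.pair A.code B.code)
  | .neg A => Nat.pair 4 A.code

theorem PropForm.code_injective : Function.Injective PropForm.code := by
  intro A
  induction A with
  | var i => intro B h; cases B <;> simp_all [PropForm.code, Nat.pair_eq_pair]
  | and A A' h₁ h₂ =>
    intro B h
    cases B <;> simp [PropForm.code, Nat.pair_eq_pair] at h
    rw [h₁ h.1, h₂ h.2]
  | or A A' h₁ h₂ =>
    intro B h
    cases B <;> simp [PropForm.code, Nat.pair_eq_pair] at h
    rw [h₁ h.1, h₂ h.2]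
  | imp A A' h₁ h₂ =>
    intro B h
    cases B <;> simp [PropForm.code, Nat.pair_eq_pair] at h
    rw [h₁ h.1, h₂ h.2]
  | neg A h₁ =>
    intro B h
    cases B <;> simp [PropForm.code, Nat.pair_eq_pair] at h
    rw [h₁ h]

theorem mk_le_continuum_of_isVariety {p : Set HeytAlg.{0} → Prop} (hp : ∀ W, p W → IsVariety W) :
    Cardinal.mk {W : Set HeytAlg.{0} // p W} ≤ Cardinal.continuum := by
  choose Γ hΓ using fun W : {W : Set HeytAlg.{0} // p W} => hp W.1 W.2
  have hinj : Function.Injective fun W => PropForm.code '' Γ W := by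
    intro W W' h
    have : Γ W = Γ W' := PropForm.code_injective.image_injective h
    exact Subtype.ext (by rw [hΓ W, hΓ W', this])
  simpa using Cardinal.mk_le_of_injective (Equiv.ulift.{1}.symm.injective.comp hinj)

theorem mk_nonJankov_eq_continuum (hV : IsVariety V) (hHV : ∀ k, H k ∈ V)
    (hinf : ∀ k, Infinite (H k)) (hSH : ∀ k m, k ≠ m → ¬ InSH (H k) (H m))
    (hχ : ∀ k, IsCharFormula V (H k) (χ k)) :
    Cardinal.mk {W : Set HeytAlg.{0} // IsVariety W ∧
      AxiomatizedByCharFormulas W ∧ ¬ AxiomatizedByJankovFormulas W} = Cardinal.continuum := by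
  refine le_antisymm (mk_le_continuum_of_isVariety fun W h => h.1) ?_
  let f : ULift.{1} (Set ℕ) → {W : Set HeytAlg.{0} // IsVariety W ∧
      AxiomatizedByCharFormulas W ∧ ¬ AxiomatizedByJankovFormulas W} := fun S =>
    ⟨Mod (χ '' insert 0 (Nat.succ '' S.down)), ⟨_, rfl⟩,
      ⟨V, hV, _, by rintro _ ⟨k, -, rfl⟩; exact ⟨_, hχ k⟩, rfl⟩,
      not_axiomatizedByJankovFormulas hV hHV hinf hχ (Set.insert_nonempty _ _)⟩
  have hf : Function.Injective f := by
    intro S S' h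
    have h1 := mod_image_injective hHV hSH hχ (congrArg Subtype.val h)
    apply ULift.down_injective
    ext n
    have h2 := Set.ext_iff.1 h1 (n + 1)
    simpa using h2
  simpa using Cardinal.mk_le_of_injective hf

end Antichain

/-! ### Kripke semantics on lower sets -/

section Kripke

variable {α : Type} [Preorder α]

theorem mem_himp {a b : LowerSet α} {x : α} : x ∈ a ⇨ b ↔ ∀ y ≤ x, y ∈ a → y ∈ b := by
  rw [← LowerSet.Iic_le, le_himp_iff]
  exact ⟨fun h y hy ha => h ⟨hy, ha⟩, fun h y hy => h y hy.1 hy.2⟩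

theorem mem_compl {a : LowerSet α} {x : α} : x ∈ aᶜ ↔ ∀ y ≤ x, y ∉ a := by
  rw [← himp_bot, mem_himp]
  rfl

variable (μ : ℕ → LowerSet α) (A B : PropForm) (x : α)

theorem mem_eval_var (i : ℕ) : x ∈ (PropForm.var i).eval μ ↔ x ∈ μ i := Iff.rfl

theorem mem_eval_and : x ∈ (A.and B).eval μ ↔ x ∈ A.eval μ ∧ x ∈ B.eval μ := Iff.rfl

theorem mem_eval_or : x ∈ (A.or B).eval μ ↔ x ∈ A.eval μ ∨ x ∈ B.eval μ := Iff.rfl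

theorem mem_eval_imp : x ∈ (A.imp B).eval μ ↔ ∀ y ≤ x, y ∈ A.eval μ → y ∈ B.eval μ := mem_himp

theorem mem_eval_neg : x ∈ A.neg.eval μ ↔ ∀ y ≤ x, y ∉ A.eval μ := mem_compl

/-- The value of a formula at a point depends only on the valuation below that point. -/
theorem mem_eval_congr {μ ν : ℕ → LowerSet α} {P : Finset ℕ} {x : α}
    (h : ∀ y ≤ x, ∀ i ∈ P, y ∈ μ i ↔ y ∈ ν i) {A : PropForm} (hA : A.vars ⊆ P) :
    x ∈ A.eval μ ↔ x ∈ A.eval ν := by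
  induction A generalizing x with
  | var i => exact h x le_rfl i (hA (by simp [PropForm.vars]))
  | and A B ihA ihB =>
    have hA := Finset.union_subset_iff.1 hA
    rw [mem_eval_and, mem_eval_and, ihA h hA.1, ihB h hA.2]
  | or A B ihA ihB =>
    have hA := Finset.union_subset_iff.1 hA
    rw [mem_eval_or, mem_eval_or, ihA h hA.1, ihB h hA.2]
  | imp A B ihA ihB =>
    have hA := Finset.union_subset_iff.1 hA
    rw [mem_eval_imp, mem_eval_imp]
    refine forall₂_congr fun y hy => ?_
    have h' := fun z (hz : z ≤ y) => h z (hz.trans hy)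
    rw [ihA h' hA.1, ihB h' hA.2]
  | neg A ihA =>
    rw [mem_eval_neg, mem_eval_neg]
    refine forall₂_congr fun y hy => ?_
    rw [ihA (fun z hz => h z (hz.trans hy)) hA]

end Kripke

/-! ### The ladder order and the type of a point -/

/-- The order of the Rieger–Nishimura ladder, extended by a point at infinity. -/
def LadLe (a b : ℕ∞) : Prop := a = b ∨ a + 2 ≤ b

theorem LadLe.refl (a : ℕ∞) : LadLe a a := .inl rfl

theorem ladLe_natCast {m n : ℕ} : LadLe m n ↔ m = n ∨ m + 2 ≤ n := by
  unfold LadLe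
  norm_cast

theorem LadLe.le {a b : ℕ∞} (h : LadLe a b) : a ≤ b := by
  rcases h with rfl | h
  · exact le_rfl
  · exact le_self_add.trans h

theorem LadLe.trans {a b c : ℕ∞} (h₁ : LadLe a b) (h₂ : LadLe b c) : LadLe a c := by
  rcases h₂ with rfl | h₂
  · exact h₁
  · exact .inr ((add_le_add_left h₁.le 2).trans h₂)

theorem LadLe.exists_natCast (a : ℕ∞) : ∃ n : ℕ, LadLe n a := by
  induction a using ENat.recTopCoe with
  | top => exact ⟨0, .inr le_top⟩
  | coe n => exact ⟨n, .refl _⟩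

section PointType

variable {α : Type} [PartialOrder α] [WellFoundedLT α] (p : LowerSet α)

open Classical in
/-- The type of a point: the place of the ladder to which a point of a model with one proposition
`p` is mapped. -/
noncomputable def pointType : α → ℕ∞ :=
  (wellFounded_lt (α := α)).fix fun x τ =>
    if x ∈ p then 0 else sInf {n | 1 ≤ n ∧ ∀ y, ∀ h : y < x, LadLe (τ y h) n}

theorem pointType_of_mem {x : α} (h : x ∈ p) : pointType p x = 0 := by
  rw [pointType, WellFounded.fix_eq, if_pos h]

theorem pointType_of_notMem {x : α} (h : x ∉ p) :
    pointType p x = sInf {n | 1 ≤ n ∧ ∀ y < x, LadLe (pointType p y) n} := by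
  rw [pointType, WellFounded.fix_eq, if_neg h]

theorem pointType_spec {x : α} (h : x ∉ p) :
    1 ≤ pointType p x ∧ ∀ y < x, LadLe (pointType p y) (pointType p x) := by
  have := csInf_mem (s := {n | 1 ≤ n ∧ ∀ y < x, LadLe (pointType p y) n})
    ⟨⊤, le_top, fun y _ => .inr le_top⟩
  rw [← pointType_of_notMem p h] at this
  exact this

theorem pointType_le {x : α} (h : x ∉ p) {n : ℕ∞} (hn : 1 ≤ n)
    (hy : ∀ y < x, LadLe (pointType p y) n) : pointType p x ≤ n := by
  rw [pointType_of_notMem p h]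
  exact sInf_le ⟨hn, hy⟩

theorem pointType_mono {x y : α} (h : y ≤ x) : LadLe (pointType p y) (pointType p x) := by
  rcases h.eq_or_lt with rfl | h'
  · exact .refl _
  · by_cases hx : x ∈ p
    · rw [pointType_of_mem p hx, pointType_of_mem p (p.lower h hx)]
      exact .refl _
    · exact (pointType_spec p hx).2 y h'

theorem exists_pointType_eq_of_add_two_le {x : α} {n : ℕ} (h : (n : ℕ∞) + 2 ≤ pointType p x) :
    ∃ y < x, pointType p y = n := by
  induction x using WellFoundedLT.induction with
  | ind x ih =>
    have hx : x ∉ p := fun hx => by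
      rw [pointType_of_mem p hx] at h
      simp at h
    by_contra! hcon
    have hle : pointType p x ≤ ((n + 1 : ℕ) : ℕ∞) := by
      refine pointType_le p hx (by norm_cast; omega) fun y hy => ?_
      have h1 : ¬ (n : ℕ∞) + 2 ≤ pointType p y := fun h1 => by
        obtain ⟨z, hz, hzn⟩ := ih y hy h1
        exact hcon z (hz.trans hy) hzn
      have h2 := hcon y hy
      generalize pointType p y = t at h1 h2
      induction t using ENat.recTopCoe with
      | top => simp at h1
      | coe j =>
        rw [ladLe_natCast]
        norm_cast at h1 h2
        omega
    have := h.trans hle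
    norm_cast at this
    omega

theorem exists_pointType_eq {x : α} {n : ℕ} (h : LadLe n (pointType p x)) :
    ∃ y ≤ x, pointType p y = n := by
  rcases h with h | h
  · exact ⟨x, le_rfl, h.symm⟩
  · obtain ⟨y, hy, hn⟩ := exists_pointType_eq_of_add_two_le p h
    exact ⟨y, hy.le, hn⟩

theorem mem_iff_forall_ladLe (x : α) :
    x ∈ p ↔ ∀ n : ℕ, LadLe n (pointType p x) → n = 0 := by
  constructor
  · intro h n hn
    rw [pointType_of_mem p h] at hn
    simpa using hn.le
  · intro h
    by_contra hx
    have h1 := (pointType_spec p hx).1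
    generalize pointType p x = t at h h1
    induction t using ENat.recTopCoe with
    | top => exact absurd (h 1 (.inr le_top)) one_ne_zero
    | coe n =>
      have := h n (.refl _)
      subst this
      simp at h1

end PointType

/-! ### The frames -/

/-- The points of the `k`-th frame: a ladder, an isolated minimal point `tip`, a point `side` above
`tip` and the first `k + 4` points of the ladder, and a greatest point `root`. -/
inductive Pt (k : ℕ) : Type
  | lad (n : ℕ) : Pt k
  | tip : Pt k
  | side : Pt k
  | root : Pt k

namespace Pt

variable {k : ℕ}

/-- The order of the `k`-th frame. -/
protected def le : Pt k → Pt k → Prop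
  | lad m, lad n => m = n ∨ m + 2 ≤ n
  | lad m, side => m < k + 4
  | tip, tip => True
  | tip, side => True
  | side, side => True
  | _, root => True
  | _, _ => False

instance : PartialOrder (Pt k) where
  le := Pt.le
  le_refl x := by cases x <;> simp [Pt.le]
  le_trans x y z h₁ h₂ := by
    cases x <;> cases y <;> cases z <;> simp [Pt.le] at * <;> omega
  le_antisymm x y h₁ h₂ := by
    cases x <;> cases y <;> simp [Pt.le] at * <;> omega

@[simp] theorem lad_le_lad {m n : ℕ} : (lad m : Pt k) ≤ lad n ↔ m = n ∨ m + 2 ≤ n := Iff.rfl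
@[simp] theorem lad_le_side {m : ℕ} : (lad m : Pt k) ≤ side ↔ m < k + 4 := Iff.rfl
@[simp] theorem tip_le_side : (tip : Pt k) ≤ side := trivial
@[simp] theorem le_root (x : Pt k) : x ≤ root := by cases x <;> trivial
@[simp] theorem not_lad_le_tip {n : ℕ} : ¬ (lad n : Pt k) ≤ tip := id
@[simp] theorem not_tip_le_lad {n : ℕ} : ¬ (tip : Pt k) ≤ lad n := id
@[simp] theorem not_side_le_lad {n : ℕ} : ¬ (side : Pt k) ≤ lad n := id
@[simp] theorem not_side_le_tip : ¬ (side : Pt k) ≤ tip := id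
@[simp] theorem not_root_le_lad {n : ℕ} : ¬ (root : Pt k) ≤ lad n := id
@[simp] theorem not_root_le_tip : ¬ (root : Pt k) ≤ tip := id
@[simp] theorem not_root_le_side : ¬ (root : Pt k) ≤ side := id

/-- A height of points witnessing well-foundedness. -/
def height : Pt k → ℕ∞
  | lad n => n
  | tip => 0
  | side => (k + 4 : ℕ)
  | root => ⊤

theorem height_lt {x y : Pt k} (h : x < y) : x.height < y.height := by
  rw [lt_iff_le_not_ge] at h
  cases x <;> cases y <;> simp [height] at * <;> norm_cast <;> omega

instance : WellFoundedLT (Pt k) :=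
  ⟨Subrelation.wf (fun h => height_lt h) (InvImage.wf height wellFounded_lt)⟩

theorem exists_minimal_le (x : Pt k) :
    ∃ b ≤ x, b = lad 0 ∨ b = lad 1 ∨ b = tip := by
  cases x with
  | lad n =>
    by_cases h : n = 1
    · exact ⟨lad 1, by simp [h], by simp⟩
    · exact ⟨lad 0, by simp; omega, by simp⟩
  | tip => exact ⟨tip, le_rfl, by simp⟩
  | side => exact ⟨tip, by simp, by simp⟩
  | root => exact ⟨tip, by simp, by simp⟩

theorem eq_of_le_minimal {x b : Pt k} (hb : b = lad 0 ∨ b = lad 1 ∨ b = tip) (h : x ≤ b) :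
    x = b := by
  rcases hb with rfl | rfl | rfl <;> cases x <;> simp at h ⊢ <;> omega

/-- The standard valuation: the first point of the ladder, the tip, and the ladder with the tip. -/
def val (k : ℕ) : ℕ → LowerSet (Pt k)
  | 0 => LowerSet.Iic (lad 0)
  | 1 => LowerSet.Iic tip
  | _ => ⟨{x | x ≠ side ∧ x ≠ root}, fun x y h hx => by
      cases x <;> cases y <;> simp at *⟩

@[simp] theorem mem_val_zero {x : Pt k} : x ∈ val k 0 ↔ x = lad 0 :=
  ⟨fun h => eq_of_le_minimal (by simp) h, fun h => h.le⟩

@[simp] theorem mem_val_one {x : Pt k} : x ∈ val k 1 ↔ x = tip :=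
  ⟨fun h => eq_of_le_minimal (by simp) h, fun h => h.le⟩

@[simp] theorem mem_val_two {x : Pt k} : x ∈ val k 2 ↔ x ≠ side ∧ x ≠ root := Iff.rfl

end Pt

/-! ### The presentations -/

open PropForm Pt

/-- The formulas defining the initial segments of the ladder. -/
def segForm : ℕ → PropForm
  | 0 => (var 0).and (var 0).neg
  | 1 => var 0
  | n + 2 => (segForm (n + 1)).or ((segForm (n + 1)).imp (segForm n))

theorem segForm_vars (n : ℕ) : (segForm n).vars ⊆ {0, 1, 2} := by
  induction n using segForm.induct with
  | case1 => simp [segForm, vars]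
  | case2 => simp [segForm, vars]
  | case3 n h₁ h₂ =>
    rw [segForm]
    exact Finset.union_subset h₁ (Finset.union_subset h₁ h₂)

/-- The formula presenting the `k`-th algebra. -/
def presForm (k : ℕ) : PropForm :=
  ((var 0).and (var 1)).neg.and <|
  ((var 2).imp ((var 1).or (var 1).neg)).and <|
  ((var 1).neg.imp (var 2)).and <|
  (((var 0).neg.and (var 1).neg).neg.imp (var 2)).and <|
  (((var 0).neg.neg.imp (var 0)).imp (var 2)).and <|
  (((var 2).imp (segForm (k + 3))).imp (var 2)).and <|
  ((((var 2).imp (segForm (k + 4))).imp (var 2)).imp (var 2))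

/-- The formula whose standard value is the opremum of the `k`-th algebra. -/
def opForm (k : ℕ) : PropForm := (var 2).or ((var 2).imp (segForm (k + 4)))

theorem presForm_vars (k : ℕ) : (presForm k).vars ⊆ {0, 1, 2} := by
  have h₁ := segForm_vars (k + 3)
  have h₂ := segForm_vars (k + 4)
  simp only [presForm, vars, Finset.union_subset_iff, h₁, h₂]
  simp

theorem opForm_vars (k : ℕ) : (opForm k).vars ⊆ {0, 1, 2} := by
  have h₂ := segForm_vars (k + 4)
  simp only [opForm, vars, Finset.union_subset_iff, h₂]
  simp

theorem lad_mem_segForm {k : ℕ} (n j : ℕ) :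
    (lad j : Pt k) ∈ (segForm n).eval (val k) ↔ j < n := by
  induction n using segForm.induct generalizing j with
  | case1 =>
    simp only [segForm, mem_eval_and, mem_eval_neg, not_lt_zero, iff_false]
    exact fun h => h.2 _ le_rfl h.1
  | case2 => simp [segForm, mem_eval_var]
  | case3 n h₁ h₂ =>
    simp only [segForm, mem_eval_or, mem_eval_imp, h₁]
    constructor
    · rintro (h | h)
      · omega
      · by_contra hj
        have := h (lad n) (by simp; omega)
        rw [h₁, h₂] at this
        omega
    · intro h
      by_cases hj : j < n + 1
      · exact .inl hj
      · right
        intro y hy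
        cases y with
        | lad i =>
          rw [h₁, h₂]
          simp at hy
          omega
        | tip => simp at hy
        | side => simp at hy
        | root => simp at hy

theorem tip_mem_segForm {k n : ℕ} (hn : 2 ≤ n) : (tip : Pt k) ∈ (segForm n).eval (val k) := by
  induction n, hn using Nat.le_induction with
  | base =>
    simp only [segForm, mem_eval_or, mem_eval_imp, mem_eval_var]
    right
    intro y hy h
    rw [mem_val_zero] at h
    subst h
    simp at hy
  | succ n hn ih =>
    obtain ⟨n, rfl⟩ : ∃ m, n = m + 1 := ⟨n - 1, by omega⟩
    rw [segForm, mem_eval_or]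
    exact .inl ih

/-- Below `side`, the conditional formula compares the heights of initial segments. -/
theorem side_mem_imp_segForm {k n : ℕ} (hn : 2 ≤ n) :
    (side : Pt k) ∈ ((var 2).imp (segForm n)).eval (val k) ↔ k + 4 ≤ n := by
  rw [mem_eval_imp]
  constructor
  · intro h
    have := h (lad (k + 3)) (by simp) (by simp [mem_eval_var])
    rw [lad_mem_segForm] at this
    omega
  · intro h y hy hy2
    cases y with
    | lad j =>
      rw [lad_mem_segForm]
      simp at hy
      omega
    | tip => exact tip_mem_segForm hn
    | side => simp [mem_eval_var] at hy2
    | root => simp [mem_eval_var] at hy2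

theorem root_notMem_imp_segForm {k n : ℕ} :
    (root : Pt k) ∉ ((var 2).imp (segForm n)).eval (val k) := by
  rw [mem_eval_imp]
  intro h
  have := h (lad n) (by simp) (by simp [mem_eval_var])
  rw [lad_mem_segForm] at this
  omega

theorem eval_presForm (k : ℕ) : (presForm k).eval (val k) = ⊤ := by
  refine top_unique fun x _ => ?_
  have hseg : ∀ y : Pt k, y ∉ val k 2 → side ≤ y := fun y hy => by
    cases y <;> simp at hy ⊢
  have hin : ∀ y : Pt k, y ∉ val k 2 → ∀ i, i < 4 → (lad i : Pt k) ≤ y := fun y hy i hi =>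
    le_trans (by simp; omega) (hseg y hy)
  refine ⟨?_, ?_, ?_, ?_, ?_, ?_, ?_⟩
  · refine (mem_eval_neg _ _ _).2 fun y _ h => ?_
    have h₁ : y = lad 0 := mem_val_zero.1 h.1
    have h₂ : y = tip := mem_val_one.1 h.2
    simp [h₁] at h₂
  · refine (mem_eval_imp _ _ _ _).2 fun y _ h => ?_
    rw [mem_eval_or, mem_eval_neg]
    have h : y ∈ val k 2 := h
    cases y with
    | lad n =>
      right
      intro z hz hz1
      have : z = tip := mem_val_one.1 hz1
      simp [this] at hz
    | tip => exact .inl (mem_val_one.2 rfl)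
    | side => simp at h
    | root => simp at h
  · refine (mem_eval_imp _ _ _ _).2 fun y _ h => ?_
    by_contra hy
    rw [mem_eval_neg] at h
    exact h tip (le_trans (by simp) (hseg y hy)) (mem_val_one.2 rfl)
  · refine (mem_eval_imp _ _ _ _).2 fun y _ h => ?_
    by_contra hy
    rw [mem_eval_neg] at h
    refine h (lad 1) (hin y hy 1 (by omega)) ?_
    rw [mem_eval_and, mem_eval_neg, mem_eval_neg]
    constructor <;> intro z hz hz' <;> rw [eq_of_le_minimal (by simp) hz] at hz' <;>
      simp [mem_eval_var] at hz'
  · refine (mem_eval_imp _ _ _ _).2 fun y _ h => ?_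
    by_contra hy
    rw [mem_eval_imp] at h
    have := h (lad 2) (hin y hy 2 (by omega)) ?_
    · simp [mem_eval_var] at this
    · refine (mem_eval_neg _ _ _).2 fun z hz hz' => ?_
      rw [mem_eval_neg] at hz'
      refine hz' (lad 0) ?_ (mem_val_zero.2 rfl)
      cases z <;> simp at hz ⊢
      omega
  · refine (mem_eval_imp _ _ _ _).2 fun y _ h => ?_
    by_contra hy
    have : side ∈ ((var 2).imp (segForm (k + 3))).eval (val k) := LowerSet.lower _ (hseg y hy) h
    rw [side_mem_imp_segForm (by omega)] at this
    omega
  · refine (mem_eval_imp _ _ _ _).2 fun y _ h => ?_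
    by_contra hy
    have := (mem_eval_imp _ _ _ _).1 h side (hseg y hy)
      ((side_mem_imp_segForm (by omega)).2 le_rfl)
    simp [mem_eval_var] at this

theorem mem_eval_opForm {k : ℕ} (x : Pt k) : x ∈ (opForm k).eval (val k) ↔ x ≠ root := by
  rw [opForm, mem_eval_or]
  cases x with
  | lad n => simp [mem_eval_var]
  | tip => simp [mem_eval_var]
  | side => simpa [mem_eval_var] using (side_mem_imp_segForm (by omega)).2 le_rfl
  | root => simpa [mem_eval_var] using root_notMem_imp_segForm

theorem isOpremum_opForm (k : ℕ) : IsOpremum ((opForm k).eval (val k)) := by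
  constructor
  · intro h
    have : (root : Pt k) ∈ (opForm k).eval (val k) := h ▸ LowerSet.mem_top
    exact (mem_eval_opForm _).1 this rfl
  · intro U hU x hx
    refine (mem_eval_opForm x).2 ?_
    rintro rfl
    exact hU (top_unique fun y _ => U.lower (le_root y) hx)

/-! ### Generation -/

theorem eval_mem_of_closed {H : Type} [HeytingAlgebra H] {T : Set H} {ν : ℕ → H} {P : Finset ℕ}
    (hν : ν '' (P : Set ℕ) ⊆ T)
    (hT : ∀ a ∈ T, ∀ b ∈ T, a ⊓ b ∈ T ∧ a ⊔ b ∈ T ∧ a ⇨ b ∈ T) (hc : ∀ a ∈ T, aᶜ ∈ T)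
    {A : PropForm} (hA : A.vars ⊆ P) : A.eval ν ∈ T := by
  induction A with
  | var i => exact hν ⟨i, by simpa [vars] using hA, rfl⟩
  | and A B ihA ihB =>
    have hA := Finset.union_subset_iff.1 hA
    exact (hT _ (ihA hA.1) _ (ihB hA.2)).1
  | or A B ihA ihB =>
    have hA := Finset.union_subset_iff.1 hA
    exact (hT _ (ihA hA.1) _ (ihB hA.2)).2.1
  | imp A B ihA ihB =>
    have hA := Finset.union_subset_iff.1 hA
    exact (hT _ (ihA hA.1) _ (ihB hA.2)).2.2
  | neg A ihA => exact hc _ (ihA hA)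

/-- The formula defining the ladder. -/
def ladForm : PropForm := (var 2).and (var 1).neg

theorem mem_eval_ladForm {k : ℕ} (x : Pt k) : x ∈ ladForm.eval (val k) ↔ ∃ n, x = lad n := by
  rw [ladForm, mem_eval_and, mem_eval_neg, mem_eval_var, mem_val_two]
  cases x with
  | lad n =>
    simp only [ne_eq, reduceCtorEq, not_false_eq_true, and_self, true_and, lad.injEq, exists_eq',
      iff_true]
    intro y hy hy'
    rw [mem_eval_var, mem_val_one] at hy'
    simp [hy'] at hy
  | tip => simpa using ⟨tip, le_rfl, mem_val_one.2 rfl⟩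
  | side => simp
  | root => simp

/-- A formula whose standard value is the principal lower set of a point. -/
def ptForm (k : ℕ) : Pt k → PropForm
  | lad 0 => var 0
  | lad (n + 1) => ((segForm (n + 1)).imp (segForm n)).and ladForm
  | tip => var 1
  | side => (var 2).imp (segForm (k + 4))
  | root => (var 0).imp (var 0)

theorem ptForm_vars (k : ℕ) (x : Pt k) : (ptForm k x).vars ⊆ {0, 1, 2} := by
  cases x with
  | lad n =>
    cases n with
    | zero => simp [ptForm, vars]
    | succ n =>
      have h₁ := segForm_vars (n + 1)
      have h₂ := segForm_vars n
      simp only [ptForm, ladForm, vars, Finset.union_subset_iff, h₁, h₂]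
      simp
  | tip => simp [ptForm, vars]
  | side =>
    have h₂ := segForm_vars (k + 4)
    simp only [ptForm, vars, Finset.union_subset_iff, h₂]
    simp
  | root => simp [ptForm, vars]

theorem eval_ptForm (k : ℕ) (x : Pt k) : (ptForm k x).eval (val k) = LowerSet.Iic x := by
  ext y
  change y ∈ (ptForm k x).eval (val k) ↔ y ≤ x
  cases x with
  | lad n =>
    cases n with
    | zero => rfl
    | succ n =>
      rw [ptForm, mem_eval_and, mem_eval_ladForm, mem_eval_imp]
      constructor
      · rintro ⟨h, j, rfl⟩
        by_contra hj
        have := h (lad n) (by simp at hj ⊢; omega)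
        rw [lad_mem_segForm, lad_mem_segForm] at this
        omega
      · intro h
        cases y with
        | lad j =>
          refine ⟨fun z hz => ?_, j, rfl⟩
          cases z with
          | lad i =>
            rw [lad_mem_segForm, lad_mem_segForm]
            simp at h hz
            omega
          | tip => simp at hz
          | side => simp at hz
          | root => simp at hz
        | tip => simp at h
        | side => simp at h
        | root => simp at h
  | tip => rfl
  | side =>
    rw [ptForm]
    cases y with
    | lad n =>
      rw [mem_eval_imp, lad_le_side]
      constructor
      · intro h
        exact (lad_mem_segForm _ _).1 (h (lad n) le_rfl (by simp [mem_eval_var]))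
      · intro h z hz hz2
        exact LowerSet.lower _ hz ((lad_mem_segForm _ _).2 h)
    | tip =>
      refine iff_of_true ?_ tip_le_side
      rw [mem_eval_imp]
      exact fun z hz _ => LowerSet.lower _ hz (tip_mem_segForm (by omega))
    | side => exact iff_of_true ((side_mem_imp_segForm (by omega)).2 le_rfl) le_rfl
    | root => exact iff_of_false root_notMem_imp_segForm not_root_le_side
  | root =>
    refine iff_of_true ?_ (le_root y)
    rw [ptForm, mem_eval_imp]
    exact fun z _ h => h

theorem finset_sup_Iic_mem {α : Type} [Preorder α] {T : Set (LowerSet α)}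
    (hbot : ⊥ ∈ T) (hsup : ∀ a ∈ T, ∀ b ∈ T, a ⊔ b ∈ T)
    (hIic : ∀ x, LowerSet.Iic x ∈ T) (s : Finset α) : s.sup LowerSet.Iic ∈ T :=
  Finset.sup_induction hbot hsup fun x _ => hIic x

theorem generates_val (k : ℕ) :
    Generates (val k '' (({0, 1, 2} : Finset ℕ) : Set ℕ)) := by
  intro T hG hT hc
  have hev : ∀ A : PropForm, A.vars ⊆ {0, 1, 2} → A.eval (val k) ∈ T := fun A hA =>
    eval_mem_of_closed hG hT hc hA
  have hIic : ∀ x : Pt k, LowerSet.Iic x ∈ T := fun x =>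
    eval_ptForm k x ▸ hev _ (ptForm_vars k x)
  have hbot : ⊥ ∈ T := by
    have := hev ((var 0).and (var 0).neg) (by simp [vars])
    simpa only [PropForm.eval, inf_compl_self] using this
  have hfin := finset_sup_Iic_mem hbot (fun a ha b hb => (hT a ha b hb).2.1) hIic
  have hle : ∀ (U : LowerSet (Pt k)) (s : Finset (Pt k)), (∀ x ∈ s, x ∈ U) →
      s.sup LowerSet.Iic ≤ U := fun U s h =>
    Finset.sup_le fun x hx => LowerSet.Iic_le.2 (h x hx)
  have hmem : ∀ (s : Finset (Pt k)), ∀ x ∈ s, x ∈ s.sup LowerSet.Iic := fun s x hx =>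
    LowerSet.Iic_le.1 (Finset.le_sup (f := LowerSet.Iic) hx)
  refine Set.eq_univ_of_forall fun U => ?_
  have hrest : ({tip, side, root} ∩ {x | x ∈ U} : Set (Pt k)).Finite :=
    (Set.toFinite {tip, side, root}).inter_of_left _
  by_cases h : {n | lad n ∈ U}.Finite
  · have hU : ((lad '' {n | (lad n : Pt k) ∈ U}) ∪
        ({tip, side, root} ∩ {x | x ∈ U})).Finite := (h.image _).union hrest
    have : U = hU.toFinset.sup LowerSet.Iic := by
      refine le_antisymm (fun x hx => hmem _ x ?_) (hle _ _ fun x hx => ?_)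
      · cases x <;> simp_all
      · rw [Set.Finite.mem_toFinset] at hx
        rcases hx with ⟨n, hn, rfl⟩ | hx
        · exact hn
        · exact hx.2
    rw [this]
    exact hfin _
  · have hlad : ∀ n, lad n ∈ U := fun n => by
      obtain ⟨j, hj, hnj⟩ := Set.Infinite.exists_gt h (n + 1)
      exact U.lower (by simp; omega) hj
    have : U = ladForm.eval (val k) ⊔ hrest.toFinset.sup LowerSet.Iic := by
      refine le_antisymm (fun x hx => ?_) (sup_le (fun x hx => ?_) (hle _ _ fun x hx => ?_))
      · cases x with
        | lad n => exact .inl ((mem_eval_ladForm _).2 ⟨n, rfl⟩)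
        | tip => exact .inr (hmem _ _ (by simpa using hx))
        | side => exact .inr (hmem _ _ (by simpa using hx))
        | root => exact .inr (hmem _ _ (by simpa using hx))
      · obtain ⟨n, rfl⟩ := (mem_eval_ladForm _).1 hx
        exact hlad n
      · rw [Set.Finite.mem_toFinset] at hx
        exact hx.2
    rw [this]
    exact (hT _ (hev _ (by simp [ladForm, vars, Finset.insert_subset_iff])) _ (hfin _)).2.1

/-! ### Models of the presentations -/

section Models

variable {α : Type}

/-- Below a point at which `var 1` and `var 2` hold and `var 0` fails, formulas are evaluated as at
the tip. -/
theorem mem_eval_iff_tip [Preorder α] {k : ℕ} {μ : ℕ → LowerSet α} {x : α}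
    (hp : ∀ y ≤ x, y ∉ μ 0) (hr : x ∈ μ 1) (hd : x ∈ μ 2) {B : PropForm}
    (hB : B.vars ⊆ {0, 1, 2}) {y : α} (hy : y ≤ x) :
    y ∈ B.eval μ ↔ (tip : Pt k) ∈ B.eval (val k) := by
  have htip : ∀ z : Pt k, z ≤ tip → z = tip := fun z hz => eq_of_le_minimal (by simp) hz
  induction B generalizing y with
  | var i =>
    have hi : i = 0 ∨ i = 1 ∨ i = 2 := by simpa [vars] using hB
    rcases hi with rfl | rfl | rfl
    · simp [mem_eval_var, hp y hy]
    · exact iff_of_true ((μ 1).lower hy hr) (mem_val_one.2 rfl)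
    · exact iff_of_true ((μ 2).lower hy hd) (by simp [mem_eval_var])
  | and A B ihA ihB =>
    have hB := Finset.union_subset_iff.1 hB
    exact and_congr (ihA hB.1 hy) (ihB hB.2 hy)
  | or A B ihA ihB =>
    have hB := Finset.union_subset_iff.1 hB
    exact or_congr (ihA hB.1 hy) (ihB hB.2 hy)
  | imp A B ihA ihB =>
    have hB := Finset.union_subset_iff.1 hB
    rw [mem_eval_imp, mem_eval_imp]
    constructor
    · intro h z hz hzA
      rw [htip z hz] at hzA ⊢
      exact (ihB hB.2 hy).1 (h y le_rfl ((ihA hB.1 hy).2 hzA))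
    · intro h z hz hzA
      exact (ihB hB.2 (hz.trans hy)).2 (h tip le_rfl ((ihA hB.1 (hz.trans hy)).1 hzA))
  | neg A ihA =>
    rw [mem_eval_neg, mem_eval_neg]
    constructor
    · intro h z hz hzA
      rw [htip z hz] at hzA
      exact h y le_rfl ((ihA hB hy).2 hzA)
    · intro h z hz hzA
      exact h tip le_rfl ((ihA hB (hz.trans hy)).1 hzA)

/-- Below a point at which `var 2` holds and `var 1` is refuted, formulas are evaluated in the
ladder, at the type of the point. -/
theorem mem_eval_iff_ladder [PartialOrder α] [WellFoundedLT α] {k : ℕ} {μ : ℕ → LowerSet α} {x : α}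
    (hr : ∀ y ≤ x, y ∉ μ 1) (hd : x ∈ μ 2) {B : PropForm}
    (hB : B.vars ⊆ {0, 1, 2}) {y : α} (hy : y ≤ x) :
    y ∈ B.eval μ ↔
      ∀ n : ℕ, LadLe n (pointType (μ 0) y) → (lad n : Pt k) ∈ B.eval (val k) := by
  have hlad : ∀ (z : Pt k) (n : ℕ), z ≤ lad n → ∃ j : ℕ, z = lad j ∧ LadLe j n := by
    intro z n hz
    cases z with
    | lad j => exact ⟨j, rfl, ladLe_natCast.2 hz⟩
    | tip => simp at hz
    | side => simp at hz
    | root => simp at hz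
  have hlow : ∀ (C : PropForm) (i j : ℕ), LadLe i j → (lad j : Pt k) ∈ C.eval (val k) →
      (lad i : Pt k) ∈ C.eval (val k) := fun C i j hij hj =>
    LowerSet.lower _ (ladLe_natCast.1 hij) hj
  induction B generalizing y with
  | var i =>
    have hi : i = 0 ∨ i = 1 ∨ i = 2 := by simpa [vars] using hB
    rcases hi with rfl | rfl | rfl
    · simpa [mem_eval_var] using mem_iff_forall_ladLe (μ 0) y
    · simpa [mem_eval_var, hr y hy] using LadLe.exists_natCast _
    · exact iff_of_true ((μ 2).lower hy hd) fun n _ => by simp [mem_eval_var]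
  | and A B ihA ihB =>
    have hB := Finset.union_subset_iff.1 hB
    simp only [mem_eval_and, ihA hB.1 hy, ihB hB.2 hy, ← forall_and]
  | or A B ihA ihB =>
    have hB := Finset.union_subset_iff.1 hB
    simp only [mem_eval_or, ihA hB.1 hy, ihB hB.2 hy]
    constructor
    · rintro (h | h) n hn
      · exact .inl (h n hn)
      · exact .inr (h n hn)
    · intro h
      generalize pointType (μ 0) y = t at h
      induction t using ENat.recTopCoe with
      | top =>
        by_contra! hcon
        obtain ⟨⟨i, -, hi⟩, j, -, hj⟩ := hcon
        rcases h (i + j + 2) (.inr le_top) with h' | h'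
        · exact hi (hlow _ _ _ (ladLe_natCast.2 (by omega)) h')
        · exact hj (hlow _ _ _ (ladLe_natCast.2 (by omega)) h')
      | coe n =>
        rcases h n (.refl _) with h' | h'
        · exact .inl fun i hi => hlow _ _ _ hi h'
        · exact .inr fun i hi => hlow _ _ _ hi h'
  | imp A B ihA ihB =>
    have hB := Finset.union_subset_iff.1 hB
    simp only [mem_eval_imp]
    constructor
    · intro h n hn z hz hzA
      obtain ⟨j, rfl, hj⟩ := hlad z n hz
      obtain ⟨w, hw, hwj⟩ := exists_pointType_eq _ (hj.trans hn)
      refine (ihB hB.2 (hw.trans hy)).1 (h w hw ((ihA hB.1 (hw.trans hy)).2 ?_)) j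
        (hwj ▸ .refl _)
      intro i hi
      rw [hwj] at hi
      exact hlow _ _ _ hi hzA
    · intro h z hz hzA
      refine (ihB hB.2 (hz.trans hy)).2 fun n hn => ?_
      exact h n (hn.trans (pointType_mono _ hz)) _ le_rfl ((ihA hB.1 (hz.trans hy)).1 hzA n hn)
  | neg A ihA =>
    simp only [mem_eval_neg]
    constructor
    · intro h n hn z hz hzA
      obtain ⟨j, rfl, hj⟩ := hlad z n hz
      obtain ⟨w, hw, hwj⟩ := exists_pointType_eq _ (hj.trans hn)
      refine h w hw ((ihA hB (hw.trans hy)).2 ?_)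
      intro i hi
      rw [hwj] at hi
      exact hlow _ _ _ hi hzA
    · intro h z hz hzA
      obtain ⟨n, hn⟩ := LadLe.exists_natCast (pointType (μ 0) z)
      exact h n (hn.trans (pointType_mono _ hz)) _ le_rfl ((ihA hB (hz.trans hy)).1 hzA n hn)

end Models

section Rigidity

variable {m : ℕ} {μ : ℕ → LowerSet (Pt m)} {x : Pt m}

/-- A point below which a valuation takes three distinct patterns at minimal points. -/
theorem exists_minimal_points
    (a1 : ∀ y ≤ x, ¬ (y ∈ μ 0 ∧ y ∈ μ 1))
    (a3 : (∀ z ≤ x, z ∉ μ 1) → x ∈ μ 2)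
    (a4 : (∀ z ≤ x, ¬ ((∀ w ≤ z, w ∉ μ 0) ∧ ∀ w ≤ z, w ∉ μ 1)) → x ∈ μ 2)
    (a5 : (∀ z ≤ x, (∀ w ≤ z, ¬ ∀ v ≤ w, v ∉ μ 0) → z ∈ μ 0) → x ∈ μ 2)
    (hd : x ∉ μ 2) :
    (x = side ∨ x = root) ∧
      ((lad 0 ∈ μ 1 ∨ lad 1 ∈ μ 1 ∨ tip ∈ μ 1) ∧
       ((lad 0 ∉ μ 0 ∧ lad 0 ∉ μ 1) ∨ (lad 1 ∉ μ 0 ∧ lad 1 ∉ μ 1) ∨ (tip ∉ μ 0 ∧ tip ∉ μ 1)) ∧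
       (lad 0 ∈ μ 0 ∨ lad 1 ∈ μ 0 ∨ tip ∈ μ 0)) := by
  have e1 : ∃ b ≤ x, (b = lad 0 ∨ b = lad 1 ∨ b = tip) ∧ b ∈ μ 1 := by
    by_contra! hcon
    refine hd (a3 fun z hz hz1 => ?_)
    obtain ⟨b, hb, hb'⟩ := exists_minimal_le z
    exact hcon b (hb.trans hz) hb' ((μ 1).lower hb hz1)
  have e2 : ∃ b ≤ x, (b = lad 0 ∨ b = lad 1 ∨ b = tip) ∧ b ∉ μ 0 ∧ b ∉ μ 1 := by
    by_contra! hcon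
    refine hd (a4 fun z hz hz1 => ?_)
    obtain ⟨b, hb, hb'⟩ := exists_minimal_le z
    exact hz1.2 b hb (hcon b (hb.trans hz) hb' (hz1.1 b hb))
  have e3 : ∃ b ≤ x, (b = lad 0 ∨ b = lad 1 ∨ b = tip) ∧ b ∈ μ 0 := by
    by_contra! hcon
    refine hd (a5 fun z hz hz1 => ?_)
    refine absurd (fun v hv hv0 => ?_) (hz1 z le_rfl)
    obtain ⟨b, hb, hb'⟩ := exists_minimal_le v
    exact hcon b (hb.trans (hv.trans hz)) hb' ((μ 0).lower hb hv0)
  obtain ⟨b₁, hb₁, hb₁', h₁⟩ := e1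
  obtain ⟨b₂, hb₂, hb₂', h₂⟩ := e2
  obtain ⟨b₃, hb₃, hb₃', h₃⟩ := e3
  have n13 : b₁ ≠ b₃ := fun h => a1 b₁ hb₁ ⟨h ▸ h₃, h₁⟩
  have n12 : b₁ ≠ b₂ := fun h => h₂.2 (h ▸ h₁)
  have n23 : b₂ ≠ b₃ := fun h => h₂.1 (h ▸ h₃)
  refine ⟨?_, ?_, ?_, ?_⟩
  · cases x with
    | lad n =>
      exfalso
      have : ∀ b : Pt m, b ≤ lad n → (b = lad 0 ∨ b = lad 1 ∨ b = tip) →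
          b = lad 0 ∨ b = lad 1 := by
        rintro b hb (h | h | rfl)
        · exact .inl h
        · exact .inr h
        · simp at hb
      rcases this _ hb₁ hb₁' with rfl | rfl <;> rcases this _ hb₂ hb₂' with rfl | rfl <;>
        rcases this _ hb₃ hb₃' with rfl | rfl <;> simp at n12 n13 n23
    | tip =>
      exact absurd ((eq_of_le_minimal (by simp) hb₁).trans
        (eq_of_le_minimal (by simp) hb₂).symm) n12
    | side => exact .inl rfl
    | root => exact .inr rfl
  · rcases hb₁' with rfl | rfl | rfl <;> simp [h₁]
  · rcases hb₂' with rfl | rfl | rfl <;> simp [h₂]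
  · rcases hb₃' with rfl | rfl | rfl <;> simp [h₃]

/-- If the presenting formula holds and `var 2` fails at a point, the valuation is the standard one
below that point, and the frames have the same index. -/
theorem eq_val_of_mem_presForm {k : ℕ} (hA : x ∈ (presForm k).eval μ) (hd : x ∉ μ 2) :
    (∀ y ≤ x, ∀ i ∈ ({0, 1, 2} : Finset ℕ), y ∈ μ i ↔ y ∈ val m i) ∧ k = m := by
  have hA' := hA
  simp only [presForm, mem_eval_and, mem_eval_or, mem_eval_imp, mem_eval_neg, mem_eval_var] at hA'
  obtain ⟨a1, a2, a3, a4, a5, -, -⟩ := hA'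
  have key : ∀ y ≤ x, y ∉ μ 2 → _ := fun y hy hyd =>
    exists_minimal_points (x := y) (fun z hz => a1 z (hz.trans hy)) (a3 y hy) (a4 y hy) (a5 y hy)
      hyd
  obtain ⟨hx, q1, q2, q3⟩ := key x le_rfl hd
  have hside : side ≤ x := by rcases hx with rfl | rfl <;> simp
  have htip : tip ≤ x := tip_le_side.trans hside
  have hlad : ∀ i, i < 4 → lad i ≤ x := fun i hi => le_trans (by simp; omega) hside
  have dlad : ∀ n, lad n ≤ x → lad n ∈ μ 2 := fun n hn => by
    by_contra h
    have := (key _ hn h).1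
    simp at this
  have dtip : tip ∈ μ 2 := by
    by_contra h
    have := (key _ htip h).1
    simp at this
  have l03 : (lad 0 : Pt m) ≤ lad 3 := by simp
  have l13 : (lad 1 : Pt m) ≤ lad 3 := by simp
  have b0 := a1 (lad 0) (hlad 0 (by omega))
  have b1 := a1 (lad 1) (hlad 1 (by omega))
  have bt := a1 tip htip
  have r3 : lad 0 ∉ μ 1 ∧ lad 1 ∉ μ 1 := by
    rcases a2 (lad 3) (hlad 3 (by omega)) (dlad 3 (hlad 3 (by omega))) with h | h
    · have h0 := (μ 1).lower l03 h
      have h1 := (μ 1).lower l13 h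
      exfalso
      have ht : tip ∉ μ 0 := by
        rcases q2 with h' | h' | h'
        · exact absurd h0 h'.2
        · exact absurd h1 h'.2
        · exact h'.1
      rcases q3 with h' | h' | h'
      · exact b0 ⟨h', h0⟩
      · exact b1 ⟨h', h1⟩
      · exact ht h'
    · exact ⟨h _ l03, h _ l13⟩
  have rtip : tip ∈ μ 1 := (q1.resolve_left r3.1).resolve_left r3.2
  have ptip : tip ∉ μ 0 := fun h => bt ⟨h, rtip⟩
  have rlad : ∀ n, lad n ∉ μ 1 := fun n h => by
    by_cases hn : n = 1
    · exact r3.2 (hn ▸ h)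
    · exact r3.1 ((μ 1).lower (show (lad 0 : Pt m) ≤ lad n by simp; omega) h)
  have hbig : ∀ y : Pt m, y = side ∨ y = root → tip ≤ y ∧ lad 0 ≤ y := by
    rintro y (rfl | rfl) <;> simp
  have p02 : lad 0 ∈ μ 0 ∧ lad 2 ∉ μ 0 := by
    have : ∃ z ≤ x, (∀ w ≤ z, ¬ ∀ v ≤ w, v ∉ μ 0) ∧ z ∉ μ 0 := by
      by_contra hcon
      refine hd (a5 x le_rfl fun z hz hz1 => ?_)
      by_contra hz2
      exact hcon ⟨z, hz, hz1, hz2⟩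
    obtain ⟨z, hz, hz1, hz2⟩ := this
    have hmin : ∀ b : Pt m, b = lad 0 ∨ b = lad 1 ∨ b = tip → b ≤ z → b ∈ μ 0 := by
      intro b hb hbz
      have := hz1 b hbz
      push Not at this
      obtain ⟨v, hv, hv0⟩ := this
      rwa [eq_of_le_minimal hb hv] at hv0
    cases z with
    | lad j =>
      have hj0 : j ≠ 0 := by rintro rfl; exact hz2 (hmin _ (by simp) le_rfl)
      have hj1 : j ≠ 1 := by rintro rfl; exact hz2 (hmin _ (by simp) le_rfl)
      have h0 : lad 0 ∈ μ 0 := hmin _ (by simp) (by simp; omega)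
      by_cases hj2 : j = 2
      · exact ⟨h0, hj2 ▸ hz2⟩
      · have h1 : lad 1 ∈ μ 0 := hmin _ (by simp) (by simp; omega)
        rcases q2 with h' | h' | h'
        · exact absurd h0 h'.1
        · exact absurd h1 h'.1
        · exact absurd rtip h'.2
    | tip => exact absurd (hmin _ (by simp) le_rfl) ptip
    | side => exact absurd (hmin _ (by simp) tip_le_side) ptip
    | root => exact absurd (hmin _ (by simp) (le_root _)) ptip
  have p1 : lad 1 ∉ μ 0 := by
    rcases q2 with h' | h' | h'
    · exact absurd p02.1 h'.1
    · exact h'.1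
    · exact absurd rtip h'.2
  have hval : ∀ y ≤ x, ∀ i ∈ ({0, 1, 2} : Finset ℕ), y ∈ μ i ↔ y ∈ val m i := by
    intro y hy i hi
    have hi : i = 0 ∨ i = 1 ∨ i = 2 := by simpa using hi
    rcases hi with rfl | rfl | rfl
    · rw [mem_val_zero]
      refine ⟨fun h => ?_, fun h => h ▸ p02.1⟩
      cases y with
      | lad n =>
        by_contra hn
        have hn0 : n ≠ 0 := by simpa using hn
        by_cases hn2 : n = 2
        · exact p02.2 (hn2 ▸ h)
        · exact p1 ((μ 0).lower (show (lad 1 : Pt m) ≤ lad n by simp; omega) h)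
      | tip => exact absurd h ptip
      | side => exact absurd ((μ 0).lower tip_le_side h) ptip
      | root => exact absurd ((μ 0).lower (le_root _) h) ptip
    · rw [mem_val_one]
      refine ⟨fun h => ?_, fun h => h ▸ rtip⟩
      cases y with
      | lad n => exact absurd h (rlad n)
      | tip => rfl
      | side => exact absurd ((μ 1).lower (hbig _ (.inl rfl)).2 h) r3.1
      | root => exact absurd ((μ 1).lower (hbig _ (.inr rfl)).2 h) r3.1
    · rw [mem_val_two]
      have hno : ∀ z ≤ x, z = side ∨ z = root → z ∉ μ 2 := by
        intro z hz hz' h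
        rcases a2 z hz h with h' | h'
        · exact r3.1 ((μ 1).lower (hbig z hz').2 h')
        · exact h' _ (hbig z hz').1 rtip
      constructor
      · intro h
        constructor
        · rintro rfl; exact hno _ hy (.inl rfl) h
        · rintro rfl; exact hno _ hy (.inr rfl) h
      · intro h
        cases y with
        | lad n => exact dlad n hy
        | tip => exact dtip
        | side => simp at h
        | root => simp at h
  refine ⟨hval, ?_⟩
  have hA2 := (mem_eval_congr hval (presForm_vars k)).1 hA
  obtain ⟨-, -, -, -, -, c1, c2⟩ := hA2
  have hs : (side : Pt m) ∉ (var 2).eval (val m) := by simp [mem_eval_var]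
  have d1 : ¬ m + 4 ≤ k + 3 := fun h =>
    hs ((mem_eval_imp _ _ _ _).1 c1 side hside ((side_mem_imp_segForm (by omega)).2 h))
  have d2 : m + 4 ≤ k + 4 := by
    by_contra hcon
    refine hs ((mem_eval_imp _ _ _ _).1 c2 side hside ((mem_eval_imp _ _ _ _).2 fun y hy h => ?_))
    cases y with
    | lad n => simp [mem_eval_var]
    | tip => simp [mem_eval_var]
    | side => exact absurd ((side_mem_imp_segForm (by omega)).1 h) hcon
    | root => simp at hy
  omega

end Rigidity

/-! ### The algebras -/

/-- The algebra of lower sets of the `k`-th frame. -/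
noncomputable abbrev ptAlg (k : ℕ) : HeytAlg.{0} := HeytAlg.of (LowerSet (Pt k))

/-- The variety generated by the algebras `ptAlg k`. -/
def ptVariety : Set HeytAlg.{0} := Mod {A | ∀ k, Valid (ptAlg k) A}

theorem isVariety_ptVariety : IsVariety ptVariety := ⟨_, rfl⟩

theorem ptAlg_mem (k : ℕ) : ptAlg k ∈ ptVariety := fun _ hA => hA k

theorem valid_presForm_imp {k : ℕ} {B : PropForm} (hB : B.vars ⊆ {0, 1, 2})
    (h : B.eval (val k) = ⊤) (m : ℕ) : Valid (ptAlg m) ((presForm k).imp B) := by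
  intro μ
  change ((presForm k).eval μ ⇨ B.eval μ : LowerSet (Pt m)) = ⊤
  rw [himp_eq_top_iff]
  intro x hx
  have hx : x ∈ (presForm k).eval μ := hx
  have htop : ∀ y : Pt k, y ∈ B.eval (val k) := fun y => h ▸ LowerSet.mem_top
  by_cases hd : x ∈ μ 2
  · have a1 := (mem_eval_neg _ _ _).1 hx.1
    have a2 := (mem_eval_imp _ _ _ _).1 hx.2.1 x le_rfl hd
    rw [mem_eval_or, mem_eval_neg] at a2
    rcases a2 with hr | hr
    · exact (mem_eval_iff_tip (k := k)
        (fun y hy hy0 => a1 y hy ⟨hy0, (μ 1).lower hy hr⟩) hr hd hB le_rfl).2 (htop _)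
    · exact (mem_eval_iff_ladder (k := k) hr hd hB le_rfl).2 fun n _ => htop _
  · obtain ⟨hval, rfl⟩ := eq_val_of_mem_presForm hx hd
    exact (mem_eval_congr hval hB).2 (htop x)

theorem defines_ptAlg (k : ℕ) :
    Defines ptVariety {0, 1, 2} (presForm k) (ptAlg k) (val k) where
  vars_subset := presForm_vars k
  generates := generates_val k
  eval_eq := eval_presForm k
  valid_imp _ hB h _ hK := hK _ fun m => valid_presForm_imp hB h m

theorem isCharFormula_ptAlg (k : ℕ) :
    IsCharFormula ptVariety (ptAlg k) ((presForm k).imp (opForm k)) :=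
  ⟨ptAlg_mem k, (isOpremum_opForm k).subdirectlyIrreducible, {0, 1, 2}, presForm k, opForm k, val k,
    defines_ptAlg k, opForm_vars k, isOpremum_opForm k, rfl⟩

theorem infinite_ptAlg (k : ℕ) : Infinite (ptAlg k) := by
  refine Infinite.of_injective (fun n : ℕ => (LowerSet.Iic (lad n) : LowerSet (Pt k))) ?_
  intro i j h
  simpa using LowerSet.Iic_injective h

theorem not_inSH_ptAlg {k m : ℕ} (hkm : k ≠ m) : ¬ InSH (ptAlg k) (ptAlg m) := by
  intro h
  refine (isCharFormula_ptAlg k).not_valid (h.valid fun μ => ?_)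
  change ((presForm k).eval μ ⇨ (opForm k).eval μ : LowerSet (Pt m)) = ⊤
  rw [himp_eq_top_iff]
  intro x hx
  by_contra hop
  exact hkm (eq_val_of_mem_presForm hx fun hd => hop (.inl hd)).2

end CharForm

theorem theorem6p5 :
    Cardinal.mk {W : Set HeytAlg.{0} // CharForm.IsVariety W ∧
        CharForm.AxiomatizedByCharFormulas W ∧ ¬ CharForm.AxiomatizedByJankovFormulas W} =
      Cardinal.continuum ∧
    ∃ V : Set HeytAlg.{0}, CharForm.IsVariety V ∧
      ∃ H : ℕ → HeytAlg.{0},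
        (∀ k, H k ∈ CharForm.FPSI V ∧ Infinite (H k)) ∧
        (∀ k m, k ≠ m → ¬ CharForm.InSH (H k) (H m)) ∧
        ∀ χ : ℕ → CharForm.PropForm, (∀ k, CharForm.IsCharFormula V (H k) (χ k)) →
          CharForm.Independent V (Set.range χ) ∧
          Function.Injective (fun S : Set ℕ => CharForm.Mod (χ '' S)) ∧
          ∀ S : Set ℕ, S.Nonempty →
            ¬ CharForm.AxiomatizedByJankovFormulas (CharForm.Mod (χ '' S)) := by
  open CharForm in
  have hSH : ∀ k m, k ≠ m → ¬ InSH (ptAlg k) (ptAlg m) := fun _ _ => not_inSH_ptAlg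
  exact ⟨mk_nonJankov_eq_continuum isVariety_ptVariety ptAlg_mem infinite_ptAlg hSH
      isCharFormula_ptAlg,
    ptVariety, isVariety_ptVariety, ptAlg,
    fun k => ⟨⟨ptAlg_mem k, (isOpremum_opForm k).subdirectlyIrreducible, _, _, _, defines_ptAlg k⟩,
      infinite_ptAlg k⟩,
    hSH, fun χ hχ => ⟨independent_range ptAlg_mem hSH hχ, mod_image_injective ptAlg_mem hSH hχ,
      fun _ hS => not_axiomatizedByJankovFormulas isVariety_ptVariety ptAlg_mem infinite_ptAlg hχ
        hS⟩⟩
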